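/- Let $n,k$ be integers with $1\le k<n/2$. A simple allowable sequence on $[n]=\{1,\dots,n\}$ is a doubly infinite sequence $\Pi=(\dots,\pi_{-1},\pi_0,\pi_1,\dots)$ of permutations of $[n]$ such that any two consecutive permutations differ by a transposition of two elements in neighboring positions, and such that $\pi_j$ is the reverse of $\pi_{j+\binom n2}$ for every $j$. A halfperiod of $\Pi$ is a sequence of $\binom n2+1$ consecutive permutations of $\Pi$. For $1\le m\le n/2$, a transposition is $m$-critical if it takes place in positions $m,m+1$ or in positions $n-m,n-m+1$. Let $E_{k-1}(\Pi)$ be the number of $k$-critical transpositions in a halfperiod of $\Pi$, and let $E_{\ge k}(\Pi)$ be the number of transpositions in a halfperiod of $\Pi$ that are $m$-critical for some $m\ge k+1$ (these numbers do not depend on the choice of the halfperiod). For a halfperiod $\pi=(\pi_0,\dots,\pi_{\binom n2})$ of $\Pi$, let $C(k,\pi_i)$ be the set of elements in the middle $n-2k$ positions of $\pi_i$, and let \[ s(k,\pi)=\min\left\{|C(k,\pi_0)\cap C(k,\pi_i)| : 0\le i\le \tbinom n2\right\}. \] Then for every simple allowable sequence $\Pi$ on $[n]$ and every halfperiod $\pi$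 of $\Pi$, with $s=s(k,\pi)$, \[ E_{\ge k}(\Pi)\le (n-2k-1)E_{k-1}(\Pi)+\binom s2\le (n-2k-1)E_{k-1}(\Pi)+\binom{n-2k-1}2, \] and moreover \[ E_{k-1}(\Pi)\ge n-s\ge 2k+1. \] -/

import Mathlib

open Finset

/-- `σ : Equiv.Perm (Fin n)` is read as the permutation `(σ 0, σ 1, …, σ (n - 1))`: `σ p` is the
element standing in position `p`. `TransposesAt σ τ i` says that `τ` arises from `σ` by
interchanging the elements standing in the `i`-th and `(i+1)`-st positions, where positions are
counted from `1` (so these are the positions `i - 1` and `i` of `Fin n`, and `1 ≤ i ≤ n - 1`). -/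
def TransposesAt {n : ℕ} (σ τ : Equiv.Perm (Fin n)) (i : ℕ) : Prop :=
  ∃ p q : Fin n, (p : ℕ) + 1 = i ∧ (q : ℕ) = i ∧ τ = σ * Equiv.swap p q

/-- A simple allowable sequence on `n` elements: a doubly infinite sequence of permutations, any
two consecutive ones differing by a transposition of neighboring elements, and such that the
permutations at distance `n.choose 2` are the reverses of each other. -/
structure SimpleAllowableSequence (n : ℕ) where
  perm : ℤ → Equiv.Perm (Fin n)
  adjacent : ∀ j : ℤ, ∃ i : ℕ, TransposesAt (perm j) (perm (j + 1)) i
  reverse : ∀ (j : ℤ) (p : Fin n), perm (j + (n.choose 2 : ℕ)) p = perm j (Fin.rev p)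

/-- The step from `σ` to `τ` is an `m`-critical transposition (`1 ≤ m ≤ n / 2`): it takes place
in positions `m` and `m + 1`, or `n - m` and `n - m + 1`. -/
def IsCriticalStep {n : ℕ} (m : ℕ) (σ τ : Equiv.Perm (Fin n)) : Prop :=
  1 ≤ m ∧ 2 * m ≤ n ∧ (TransposesAt σ τ m ∨ TransposesAt σ τ (n - m))

open Classical in
/-- The number of transpositions in a sequence `π = (π 0, …, π (n.choose 2))` of permutations that
are `m`-critical for some `m ∈ M`. -/
noncomputable def criticalCount {n : ℕ} (M : Set ℕ)
    (π : Fin (n.choose 2 + 1) → Equiv.Perm (Fin n)) : ℕ :=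
  #{t : Fin (n.choose 2) | ∃ m ∈ M, IsCriticalStep m (π t.castSucc) (π t.succ)}

/-- The `k`-center of a permutation: the set of elements in its middle `n - 2k` positions. -/
def kCenter {n : ℕ} (k : ℕ) (σ : Equiv.Perm (Fin n)) : Finset (Fin n) :=
  ({p : Fin n | k ≤ (p : ℕ) ∧ (p : ℕ) + k < n} : Finset (Fin n)).image σ

/-- `s(k, π)`: the minimum over `i` of the number of elements common to the `k`-centers of
`π 0` and `π i`. -/
def centerMin {n : ℕ} (k : ℕ) (π : Fin (n.choose 2 + 1) → Equiv.Perm (Fin n)) : ℕ :=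
  (Finset.univ : Finset (Fin (n.choose 2 + 1))).inf' Finset.univ_nonempty
    (fun i => #(kCenter k (π 0) ∩ kCenter k (π i)))

namespace SimpleAllowableSequence

variable {n : ℕ} (S : SimpleAllowableSequence n)

/-- The sequence of `n.choose 2 + 1` consecutive permutations of `S` that starts at index `a`. -/
def window (a : ℤ) : Fin (n.choose 2 + 1) → Equiv.Perm (Fin n) :=
  fun t => S.perm (a + (t : ℕ))

/-- A halfperiod of `S`: any sequence of `n.choose 2 + 1` consecutive permutations of `S`. -/
def IsHalfperiod (π : Fin (n.choose 2 + 1) → Equiv.Perm (Fin n)) : Prop :=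
  ∃ a : ℤ, π = S.window a

/-- `E_k(S)`: the number of `(k+1)`-critical transpositions in a halfperiod of `S`
(the choice of the halfperiod is immaterial by `criticalCount_eq_of_isHalfperiod`). -/
noncomputable def E (k : ℕ) : ℕ := criticalCount {k + 1} (S.window 0)

/-- `E_{≥ k}(S)`: the number of `(≥ k+1)`-critical transpositions in a halfperiod of `S`
(the choice of the halfperiod is immaterial by `criticalCount_eq_of_isHalfperiod`). -/
noncomputable def Ege (k : ℕ) : ℕ := criticalCount (Set.Ici (k + 1)) (S.window 0)

end SimpleAllowableSequence

theorem TransposesAt.rev {n : ℕ} {σ τ σ' τ' : Equiv.Perm (Fin n)} {i : ℕ}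
    (hσ : ∀ p, σ' p = σ p.rev) (hτ : ∀ p, τ' p = τ p.rev) (h : TransposesAt σ τ i) :
    TransposesAt σ' τ' (n - i) := by
  obtain ⟨p, q, hp, hq, rfl⟩ := h
  refine ⟨q.rev, p.rev, ?_, ?_, ?_⟩
  · simp only [Fin.val_rev]; omega
  · simp only [Fin.val_rev]; omega
  · ext x : 1
    rw [hτ, Equiv.Perm.mul_apply, Equiv.Perm.mul_apply, hσ]
    congr 1
    simp only [Equiv.swap_apply_def, Fin.rev_eq_iff]
    split_ifs <;> simp_all

theorem IsCriticalStep.rev {n : ℕ} {σ τ σ' τ' : Equiv.Perm (Fin n)} {m : ℕ}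
    (hσ : ∀ p, σ' p = σ p.rev) (hτ : ∀ p, τ' p = τ p.rev) (h : IsCriticalStep m σ τ) :
    IsCriticalStep m σ' τ' := by
  obtain ⟨h1, h2, h3⟩ := h
  refine ⟨h1, h2, ?_⟩
  rcases h3 with h3 | h3
  · exact Or.inr (h3.rev hσ hτ)
  · have := h3.rev hσ hτ
    rw [Nat.sub_sub_self (by omega)] at this
    exact Or.inl this

namespace SimpleAllowableSequence

variable {n : ℕ} (S : SimpleAllowableSequence n)

theorem isCriticalStep_add_choose (m : ℕ) (j : ℤ) :
    IsCriticalStep m (S.perm (j + (n.choose 2 : ℕ))) (S.perm (j + (n.choose 2 : ℕ) + 1)) ↔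
      IsCriticalStep m (S.perm j) (S.perm (j + 1)) := by
  have h1 := S.reverse j
  have h2 := S.reverse (j + 1)
  rw [add_right_comm] at h2
  constructor
  · exact IsCriticalStep.rev (fun p => by rw [h1, Fin.rev_rev]) (fun p => by rw [h2, Fin.rev_rev])
  · exact IsCriticalStep.rev h1 h2

open Classical in
theorem criticalCount_window (M : Set ℕ) (a : ℤ) :
    criticalCount M (S.window a) = ∑ t ∈ Finset.range (n.choose 2),
      if ∃ m ∈ M, IsCriticalStep m (S.perm (a + (t : ℕ))) (S.perm (a + (t : ℕ) + 1))
        then 1 else 0 := by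
  rw [criticalCount, Finset.card_filter, Finset.sum_range]
  refine Finset.sum_congr rfl fun t _ => ?_
  simp [window, add_assoc]

theorem criticalCount_window_succ (M : Set ℕ) (a : ℤ) :
    criticalCount M (S.window (a + 1)) = criticalCount M (S.window a) := by
  classical
  rw [criticalCount_window, criticalCount_window]
  have key := (Finset.sum_range_succ (fun t : ℕ =>
    if ∃ m ∈ M, IsCriticalStep m (S.perm (a + (t : ℕ))) (S.perm (a + (t : ℕ) + 1))
      then 1 else 0) (n.choose 2)).symm.trans (Finset.sum_range_succ' _ _)
  simp only [isCriticalStep_add_choose, Nat.cast_zero, add_zero, Nat.cast_add, Nat.cast_one] at key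
  rw [add_left_inj] at key
  rw [key]
  refine Finset.sum_congr rfl fun t _ => ?_
  rw [add_right_comm a 1, ← add_assoc]

/-- The number of critical transpositions is the same in any halfperiod of `S`. -/
theorem criticalCount_eq_of_isHalfperiod (M : Set ℕ)
    {π : Fin (n.choose 2 + 1) → Equiv.Perm (Fin n)} (hπ : S.IsHalfperiod π) :
    criticalCount M π = criticalCount M (S.window 0) := by
  obtain ⟨a, rfl⟩ := hπ
  induction a using Int.induction_on with
  | zero => rfl
  | succ i ih => rw [criticalCount_window_succ, ih]
  | pred i ih => rw [← ih, ← criticalCount_window_succ, sub_add_cancel]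

end SimpleAllowableSequence

/-! Over a halfperiod the order of every two elements is reversed, so each pair is interchanged, and
as there are `n.choose 2` steps, exactly once (`swapped_injOn`). A transposition counted by `Ege k`
interchanges a pair lying inside the current center, so it suffices to count the pairs that are ever
together in the center.

The center is the same set at both ends of the halfperiod. Hence a pair that is in the center at
some time and never newly comes together there lies in both the initial center and the one at time
`i`; with `i` attaining the minimum this gives at most `s.choose 2` pairs. Every other pair is
created when an element enters the center, which takes a `k`-critical step and creates at most `n -
2k - 1` pairs (`Ege_le`).

For the lower bound on `E (k - 1)`, each element outside the intersection of these two centers must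
enter one of the two outer zones, at the cost of a `k`-critical step of its own
(`sub_card_inter_le_E`). Finally `s < n - 2k`, because some `k`-critical step occurs and the center
cannot stay constant across it (`exists_card_inter_lt`). -/

theorem TransposesAt.unique {n : ℕ} {σ τ : Equiv.Perm (Fin n)} {i j : ℕ}
    (hi : TransposesAt σ τ i) (hj : TransposesAt σ τ j) : i = j := by
  obtain ⟨p, q, hp, hq, rfl⟩ := hi
  obtain ⟨p', q', hp', hq', h⟩ := hj
  have h1 : Equiv.swap p q p = Equiv.swap p' q' p := by rw [mul_left_cancel h]
  rw [Equiv.swap_apply_left, Equiv.swap_apply_def] at h1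
  split_ifs at h1 with h2 h3
  · subst h2; omega
  · subst h3 h1; omega
  · subst h1; omega

/-! ### Zones of positions under one adjacent transposition -/

/-- The set of elements standing in the positions `lo, …, hi - 1` (counted from `0`). -/
def zone {n : ℕ} (lo hi : ℕ) (σ : Equiv.Perm (Fin n)) : Finset (Fin n) :=
  {x | lo ≤ (σ.symm x : ℕ) ∧ (σ.symm x : ℕ) < hi}

theorem mem_zone {n lo hi : ℕ} {σ : Equiv.Perm (Fin n)} {x : Fin n} :
    x ∈ zone lo hi σ ↔ lo ≤ (σ.symm x : ℕ) ∧ (σ.symm x : ℕ) < hi := by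
  simp [zone]

theorem kCenter_eq_zone {n k : ℕ} (σ : Equiv.Perm (Fin n)) :
    kCenter k σ = zone k (n - k) σ := by
  ext x
  simp only [kCenter, mem_image, mem_filter, mem_univ, true_and, mem_zone]
  constructor
  · rintro ⟨p, hp, rfl⟩
    rw [Equiv.symm_apply_apply]
    omega
  · intro h
    exact ⟨σ.symm x, by omega, σ.apply_symm_apply x⟩

theorem card_kCenter {n k : ℕ} (σ : Equiv.Perm (Fin n)) : #(kCenter k σ) = n - 2 * k := by
  rw [kCenter, card_image_of_injective _ σ.injective, ← card_map Fin.valEmbedding]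
  have : ({p : Fin n | k ≤ (p : ℕ) ∧ (p : ℕ) + k < n} : Finset (Fin n)).map Fin.valEmbedding =
      Finset.Ico k (n - k) := by
    ext a
    simp only [mem_map, mem_filter, mem_univ, true_and, Fin.valEmbedding_apply, Finset.mem_Ico]
    constructor
    · rintro ⟨p, hp, rfl⟩
      omega
    · intro h
      exact ⟨⟨a, by omega⟩, by simp only; omega, rfl⟩
  rw [this, Nat.card_Ico]
  omega

/-- An adjacent transposition lets at most one element enter a zone, and only if it takes place
at an end of the zone. -/
theorem TransposesAt.exists_zone_subset_insert {n : ℕ} {σ τ : Equiv.Perm (Fin n)} {i : ℕ}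
    (h : TransposesAt σ τ i) (lo hi : ℕ) :
    ∃ y, ∀ x ∈ zone lo hi τ, x ∉ zone lo hi σ → x = y ∧ (i = lo ∨ i = hi) := by
  obtain ⟨p, q, hp, hq, rfl⟩ := h
  -- An element entering at the left end comes from position `lo - 1`, which is `p`; one entering at
  -- the right end comes from position `hi`, which is `q`.
  refine ⟨if i = lo then σ p else σ q, fun x h1 h2 => ?_⟩
  rw [mem_zone] at h1 h2
  obtain ⟨a, rfl⟩ := σ.surjective x
  have e : (σ * Equiv.swap p q).symm (σ a) = Equiv.swap p q a := by
    rw [Equiv.symm_apply_eq, Equiv.Perm.mul_apply, Equiv.swap_apply_self]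
  rw [e] at h1
  rw [Equiv.symm_apply_apply] at h2
  rw [Equiv.swap_apply_def] at h1
  split_ifs at h1 with h3 h4
  · subst h3
    rw [if_pos (by omega)]
    exact ⟨rfl, by omega⟩
  · subst h4
    rw [if_neg (by omega)]
    exact ⟨rfl, by omega⟩
  · exact absurd h1 h2

theorem TransposesAt.card_zone_sdiff_le {n : ℕ} {σ τ : Equiv.Perm (Fin n)} {i : ℕ}
    (h : TransposesAt σ τ i) (lo hi : ℕ) :
    #(zone lo hi τ \ zone lo hi σ) ≤ if i = lo ∨ i = hi then 1 else 0 := by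
  obtain ⟨y, hy⟩ := h.exists_zone_subset_insert lo hi
  split_ifs with hc
  · refine card_le_one.2 fun x hx z hz => ?_
    rw [mem_sdiff] at hx hz
    rw [(hy x hx.1 hx.2).1, (hy z hz.1 hz.2).1]
  · rw [Nat.le_zero, card_eq_zero, sdiff_eq_empty_iff_subset]
    intro x hx
    by_contra hx'
    exact hc (hy x hx hx').2

/-- The pairs of elements that come together in a zone by an adjacent transposition. -/
theorem TransposesAt.card_pairs_sdiff_le {n : ℕ} {σ τ : Equiv.Perm (Fin n)} {i : ℕ}
    (h : TransposesAt σ τ i) (lo hi : ℕ) :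
    #((zone lo hi τ).powersetCard 2 \ (zone lo hi σ).powersetCard 2) ≤
      (#(zone lo hi τ) - 1) * if i = lo ∨ i = hi then 1 else 0 := by
  obtain ⟨y, hy⟩ := h.exists_zone_subset_insert lo hi
  have key : ∀ P ∈ (zone lo hi τ).powersetCard 2 \ (zone lo hi σ).powersetCard 2,
      y ∈ P ∧ y ∈ zone lo hi τ ∧ (i = lo ∨ i = hi) := by
    intro P hP
    simp only [mem_sdiff, mem_powersetCard, not_and] at hP
    obtain ⟨⟨h1, h2⟩, h3⟩ := hP
    obtain ⟨x, hxP, hx⟩ := not_subset.1 fun h4 => h3 h4 h2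
    obtain ⟨rfl, hi⟩ := hy x (h1 hxP) hx
    exact ⟨hxP, h1 hxP, hi⟩
  rcases (((zone lo hi τ).powersetCard 2 \ (zone lo hi σ).powersetCard 2)).eq_empty_or_nonempty
    with h0 | ⟨P₀, hP₀⟩
  · rw [h0, card_empty]
    exact Nat.zero_le _
  · obtain ⟨-, hyτ, hc⟩ := key P₀ hP₀
    rw [if_pos hc, mul_one, ← card_erase_of_mem hyτ]
    refine (card_le_card fun P hP => ?_).trans
      (card_image_le (s := (zone lo hi τ).erase y) (f := fun z => ({y, z} : Finset (Fin n))))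
    have hyP := (key P hP).1
    rw [mem_sdiff, mem_powersetCard] at hP
    obtain ⟨z, hz⟩ := card_eq_one.1 (show #(P.erase y) = 1 by
      rw [card_erase_of_mem hyP, hP.1.2])
    have hz' : z ∈ P.erase y := hz ▸ mem_singleton_self z
    refine mem_image.2 ⟨z, mem_erase.2 ⟨(mem_erase.1 hz').1, hP.1.1 (mem_erase.1 hz').2⟩, ?_⟩
    rw [← insert_erase hyP, hz]

/-- The order of two elements changes only if they are transposed. -/
theorem TransposesAt.eq_pair_of_lt {n : ℕ} {σ τ : Equiv.Perm (Fin n)} {i : ℕ} {p q x y : Fin n}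
    (hp : (p : ℕ) + 1 = i) (hq : (q : ℕ) = i) (h : τ = σ * Equiv.swap p q)
    (h1 : σ.symm x < σ.symm y) (h2 : ¬ τ.symm x < τ.symm y) :
    ({σ p, σ q} : Finset (Fin n)) = {x, y} := by
  subst h
  obtain ⟨a, rfl⟩ := σ.surjective x
  obtain ⟨b, rfl⟩ := σ.surjective y
  have e : ∀ a, (σ * Equiv.swap p q).symm (σ a) = Equiv.swap p q a := fun a => by
    rw [Equiv.symm_apply_eq, Equiv.Perm.mul_apply, Equiv.swap_apply_self]
  rw [e, e] at h2
  rw [Equiv.symm_apply_apply, Equiv.symm_apply_apply] at h1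
  have : a = p ∧ b = q := by
    simp only [Equiv.swap_apply_def, Fin.ext_iff, Fin.lt_def] at *
    split_ifs at h2 <;> constructor <;> omega
  rw [this.1, this.2]

/-! ### Transpositions and pairs in a halfperiod -/

namespace SimpleAllowableSequence

variable {n : ℕ} (S : SimpleAllowableSequence n)

/-- The position (counted from `1`) of the left element of the `j`-th transposition. -/
noncomputable def place (j : ℤ) : ℕ := (S.adjacent j).choose

theorem transposesAt_place (j : ℤ) : TransposesAt (S.perm j) (S.perm (j + 1)) (S.place j) :=
  (S.adjacent j).choose_spec

theorem transposesAt_iff (j : ℤ) (i : ℕ) :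
    TransposesAt (S.perm j) (S.perm (j + 1)) i ↔ S.place j = i :=
  ⟨(S.transposesAt_place j).unique, fun h => h ▸ S.transposesAt_place j⟩

theorem place_pos (j : ℤ) : 0 < S.place j := by
  obtain ⟨p, q, hp, hq, -⟩ := S.transposesAt_place j
  omega

theorem place_lt (j : ℤ) : S.place j < n := by
  obtain ⟨p, q, hp, hq, -⟩ := S.transposesAt_place j
  omega

/-- The two elements interchanged by the `j`-th transposition. -/
noncomputable def swapped (j : ℤ) : Finset (Fin n) :=
  {S.perm j (S.transposesAt_place j).choose,
    S.perm j (S.transposesAt_place j).choose_spec.choose}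

theorem swapped_spec (j : ℤ) : ∃ p q : Fin n, (p : ℕ) + 1 = S.place j ∧ (q : ℕ) = S.place j ∧
    S.perm (j + 1) = S.perm j * Equiv.swap p q ∧ S.swapped j = {S.perm j p, S.perm j q} :=
  have h := (S.transposesAt_place j).choose_spec.choose_spec
  ⟨_, _, h.1, h.2.1, h.2.2, rfl⟩

theorem card_swapped (j : ℤ) : #(S.swapped j) = 2 := by
  obtain ⟨p, q, hp, hq, -, h⟩ := S.swapped_spec j
  rw [h, card_pair]
  intro h
  have := (S.perm j).injective h
  subst this
  omega

theorem symm_add_choose (j : ℤ) (x : Fin n) :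
    (S.perm (j + (n.choose 2 : ℕ))).symm x = ((S.perm j).symm x).rev := by
  rw [Equiv.symm_apply_eq, S.reverse, Fin.rev_rev, Equiv.apply_symm_apply]

/-- Otherwise `x` and `y` would keep their order through the halfperiod, whose last permutation is
the reverse of the first. -/
theorem exists_swapped_eq (a : ℤ) {x y : Fin n} (hxy : x ≠ y) :
    ∃ t < n.choose 2, S.swapped (a + (t : ℕ)) = {x, y} := by
  wlog h : (S.perm a).symm x < (S.perm a).symm y generalizing x y
  · rw [pair_comm]
    refine this hxy.symm (lt_of_le_of_ne (not_lt.1 h) fun h' => hxy ?_)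
    exact ((S.perm a).symm.injective h').symm
  by_contra! hne
  have : ∀ t ≤ n.choose 2, (S.perm (a + (t : ℕ))).symm x < (S.perm (a + (t : ℕ))).symm y := by
    intro t
    induction t with
    | zero => simpa using h
    | succ t ih =>
      intro ht
      obtain ⟨p, q, hp, hq, he, hs⟩ := S.swapped_spec (a + (t : ℕ))
      by_contra hlt
      rw [Nat.cast_succ, ← add_assoc] at hlt
      exact hne t ht (hs.trans (TransposesAt.eq_pair_of_lt hp hq he (ih (by omega)) hlt))
  have h' := this _ le_rfl
  rw [symm_add_choose, symm_add_choose, Fin.rev_lt_rev] at h'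
  exact lt_asymm h h'

/-- In a halfperiod no pair of elements is interchanged twice. -/
theorem swapped_injOn (a : ℤ) :
    Set.InjOn (fun t : ℕ => S.swapped (a + t)) (range (n.choose 2)) := by
  -- There are as many steps as pairs, so surjectivity onto the pairs forces injectivity.
  refine injOn_of_surjOn_of_card_le (t := (univ : Finset (Fin n)).powersetCard 2)
    _ (fun t _ => ?_) (fun P hP => ?_) (by simp)
  · simpa using S.card_swapped (a + t)
  · obtain ⟨x, y, hxy, rfl⟩ := card_eq_two.1 (mem_powersetCard.1 hP).2
    obtain ⟨t, ht, h⟩ := S.exists_swapped_eq a hxy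
    exact ⟨t, by simpa using ht, h⟩

theorem card_zone_sdiff_le_sum (a : ℤ) (lo hi : ℕ) {u v : ℕ} (huv : u ≤ v) :
    #(zone lo hi (S.perm (a + v)) \ zone lo hi (S.perm (a + u))) ≤
      ∑ t ∈ Finset.Ico u v, if S.place (a + (t : ℕ)) = lo ∨ S.place (a + (t : ℕ)) = hi
        then 1 else 0 := by
  induction v, huv using Nat.le_induction with
  | base => simp
  | succ v huv ih =>
    rw [sum_Ico_succ_top huv]
    have h := (S.transposesAt_place (a + (v : ℕ))).card_zone_sdiff_le lo hi
    rw [add_assoc, ← Nat.cast_succ] at h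
    refine le_trans (card_le_card fun x hx => ?_) ((card_union_le _ _).trans (add_le_add ih h))
    simp only [mem_union, mem_sdiff] at hx ⊢
    tauto

theorem zone_add_choose (a : ℤ) {lo hi : ℕ} (h : hi ≤ n) :
    zone lo hi (S.perm (a + (n.choose 2 : ℕ))) = zone (n - hi) (n - lo) (S.perm a) := by
  ext x
  rw [mem_zone, mem_zone, symm_add_choose, Fin.val_rev]
  omega

theorem exists_isCriticalStep_iff (M : Set ℕ) (j : ℤ) :
    (∃ m ∈ M, IsCriticalStep m (S.perm j) (S.perm (j + 1))) ↔
      ∃ m ∈ M, 1 ≤ m ∧ 2 * m ≤ n ∧ (S.place j = m ∨ S.place j = n - m) := by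
  simp only [IsCriticalStep, transposesAt_iff]

theorem E_eq_sum {k : ℕ} (hk : 1 ≤ k) (hkn : 2 * k < n) (a : ℤ) :
    S.E (k - 1) = ∑ t ∈ range (n.choose 2),
      if S.place (a + (t : ℕ)) = k ∨ S.place (a + (t : ℕ)) = n - k then 1 else 0 := by
  classical
  rw [E, Nat.sub_add_cancel hk, ← S.criticalCount_eq_of_isHalfperiod _ ⟨a, rfl⟩,
    criticalCount_window]
  refine sum_congr rfl fun t _ => if_congr ?_ rfl rfl
  rw [exists_isCriticalStep_iff]
  simp only [Set.mem_singleton_iff, exists_eq_left]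
  omega

theorem Ege_eq_card (k : ℕ) (a : ℤ) :
    S.Ege k = #{t ∈ range (n.choose 2) |
      k < S.place (a + (t : ℕ)) ∧ S.place (a + (t : ℕ)) < n - k} := by
  classical
  rw [Ege, ← S.criticalCount_eq_of_isHalfperiod _ ⟨a, rfl⟩, criticalCount_window, card_filter]
  refine sum_congr rfl fun t _ => if_congr ?_ rfl rfl
  rw [exists_isCriticalStep_iff]
  have := S.place_pos (a + t)
  have := S.place_lt (a + t)
  simp only [Set.mem_Ici]
  constructor
  · rintro ⟨m, h⟩
    omega
  · intro h
    rcases le_total (2 * S.place (a + t)) n with h' | h'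
    · exact ⟨S.place (a + t), by omega⟩
    · exact ⟨n - S.place (a + t), by omega⟩

/-! ### The two bounds and the strict drop of the center -/

/-- An element starting in an outer zone ends in the opposite one and must enter it; an element of
the initial center that is outside the center at time `i` has entered an outer zone by then. -/
theorem sub_card_inter_le_E {k : ℕ} (hk : 1 ≤ k) (hkn : 2 * k < n) (a : ℤ) {i : ℕ}
    (hi : i ≤ n.choose 2) :
    n - #(kCenter k (S.perm a) ∩ kCenter k (S.perm (a + i))) ≤ S.E (k - 1) := by
  have hL1 := S.card_zone_sdiff_le_sum a 0 k (Nat.zero_le i)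
  have hL2 := S.card_zone_sdiff_le_sum a 0 k hi
  have hR1 := S.card_zone_sdiff_le_sum a (n - k) n (Nat.zero_le i)
  have hR2 := S.card_zone_sdiff_le_sum a (n - k) n hi
  rw [S.zone_add_choose a (by omega)] at hL2 hR2
  rw [Nat.cast_zero, add_zero] at hL1 hR1
  -- The outer ends `0` and `n` of the outer zones never occur as places, so only the inner ends `k`
  -- and `n - k` contribute.
  have hsum : S.E (k - 1) = (∑ t ∈ range (n.choose 2),
        if S.place (a + (t : ℕ)) = 0 ∨ S.place (a + (t : ℕ)) = k then 1 else 0) +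
      ∑ t ∈ range (n.choose 2),
        if S.place (a + (t : ℕ)) = n - k ∨ S.place (a + (t : ℕ)) = n then 1 else 0 := by
    rw [S.E_eq_sum hk hkn a, ← sum_add_distrib]
    refine sum_congr rfl fun t _ => ?_
    have := S.place_pos (a + t)
    have := S.place_lt (a + t)
    split_ifs <;> omega
  rw [hsum, range_eq_Ico, ← sum_Ico_consecutive _ (Nat.zero_le i) hi,
    ← sum_Ico_consecutive _ (Nat.zero_le i) hi]
  refine le_trans ?_ (add_le_add (add_le_add hL1 hL2) (add_le_add hR1 hR2))
  have hn : n - #(kCenter k (S.perm a) ∩ kCenter k (S.perm (a + i))) =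
      #(kCenter k (S.perm a) ∩ kCenter k (S.perm (a + i)))ᶜ := by
    rw [card_compl, Fintype.card_fin]
  rw [hn]
  refine le_trans (card_le_card fun x hx => ?_) ((card_union_le _ _).trans
    (add_le_add (card_union_le _ _) (card_union_le _ _)))
  simp only [kCenter_eq_zone, mem_compl, mem_union, mem_inter, mem_sdiff, mem_zone] at hx ⊢
  have := ((S.perm a).symm x).isLt
  have := ((S.perm (a + i)).symm x).isLt
  omega

theorem exists_card_inter_lt {k : ℕ} (hk : 1 ≤ k) (hkn : 2 * k < n) (a : ℤ) :
    ∃ i ≤ n.choose 2,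
      #(kCenter k (S.perm a) ∩ kCenter k (S.perm (a + (i : ℕ)))) < n - 2 * k := by
  by_contra! hall
  have heq : ∀ i ≤ n.choose 2, kCenter k (S.perm (a + (i : ℕ))) = kCenter k (S.perm a) := by
    intro i hi
    have h1 : kCenter k (S.perm a) ∩ kCenter k (S.perm (a + (i : ℕ))) = kCenter k (S.perm a) :=
      eq_of_subset_of_card_le inter_subset_left ((card_kCenter _).trans_le (hall i hi))
    exact (eq_of_subset_of_card_le (inter_eq_left.1 h1)
      (by rw [card_kCenter, card_kCenter])).symm
  have hE : 0 < S.E (k - 1) := by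
    refine lt_of_lt_of_le ?_ (S.sub_card_inter_le_E hk hkn a (Nat.zero_le _))
    have := card_le_card (inter_subset_left (s₁ := kCenter k (S.perm a))
      (s₂ := kCenter k (S.perm (a + (0 : ℕ)))))
    rw [card_kCenter] at this
    omega
  rw [S.E_eq_sum hk hkn a] at hE
  obtain ⟨t, ht, hpos⟩ := exists_ne_zero_of_sum_ne_zero hE.ne'
  rw [mem_range] at ht
  have hplace := (ite_ne_right_iff.1 hpos).1
  obtain ⟨p, q, hp, hq, he, -⟩ := S.swapped_spec (a + t)
  have h := (heq (t + 1) ht).trans (heq t ht.le).symm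
  rw [Nat.cast_succ, ← add_assoc] at h
  -- At place `k` or `n - k`, the element at `p` crosses the boundary of the center.
  have hx := Finset.ext_iff.1 h (S.perm (a + t) p)
  have e : (S.perm (a + t + 1)).symm (S.perm (a + t) p) = q := by
    rw [Equiv.symm_apply_eq, he, Equiv.Perm.mul_apply, Equiv.swap_apply_right]
  rw [kCenter_eq_zone, kCenter_eq_zone, mem_zone, mem_zone, e, Equiv.symm_apply_apply] at hx
  omega

theorem swapped_subset_kCenter {k : ℕ} {j : ℤ} (h1 : k < S.place j) (h2 : S.place j < n - k) :
    S.swapped j ⊆ kCenter k (S.perm j) := by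
  obtain ⟨p, q, hp, hq, -, hs⟩ := S.swapped_spec j
  rw [hs, kCenter_eq_zone]
  intro x hx
  rw [mem_insert, mem_singleton] at hx
  rw [mem_zone]
  rcases hx with rfl | rfl <;> rw [Equiv.symm_apply_apply] <;> omega

theorem Ege_le {k : ℕ} (hk : 1 ≤ k) (hkn : 2 * k < n) (a : ℤ) {i : ℕ} (hi : i ≤ n.choose 2) :
    S.Ege k ≤ (n - 2 * k - 1) * S.E (k - 1) +
      (#(kCenter k (S.perm a) ∩ kCenter k (S.perm (a + (i : ℕ))))).choose 2 := by
  have hcard : ∀ j, #(zone k (n - k) (S.perm j)) = n - 2 * k := fun j => by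
    rw [← kCenter_eq_zone, card_kCenter]
  have hper : kCenter k (S.perm (a + (n.choose 2 : ℕ))) = kCenter k (S.perm a) := by
    rw [kCenter_eq_zone, kCenter_eq_zone, S.zone_add_choose a (by omega),
      Nat.sub_sub_self (by omega)]
  set C : ℕ → Finset (Fin n) := fun t => kCenter k (S.perm (a + (t : ℕ))) with hC
  have hnew : ∀ t, #((C (t + 1)).powersetCard 2 \ (C t).powersetCard 2) ≤ (n - 2 * k - 1) *
      if S.place (a + (t : ℕ)) = k ∨ S.place (a + (t : ℕ)) = n - k then 1 else 0 := by
    intro t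
    have h := (S.transposesAt_place (a + (t : ℕ))).card_pairs_sdiff_le k (n - k)
    rw [hcard, ← kCenter_eq_zone, ← kCenter_eq_zone, add_assoc, ← Nat.cast_succ] at h
    exact h
  rw [S.Ege_eq_card k a, S.E_eq_sum hk hkn a, mul_sum, ← card_powersetCard, add_comm,
    ← card_image_of_injOn ((S.swapped_injOn a).mono (coe_subset.2 (filter_subset _ _)))]
  refine le_trans (card_le_card (t := (kCenter k (S.perm a) ∩ C i).powersetCard 2 ∪
    (range (n.choose 2)).biUnion fun t => (C (t + 1)).powersetCard 2 \ (C t).powersetCard 2) ?_)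
    ((card_union_le _ _).trans (add_le_add le_rfl (card_biUnion_le.trans
      (sum_le_sum fun t _ => hnew t))))
  intro P hP
  obtain ⟨t, ht, rfl⟩ := mem_image.1 hP
  rw [mem_filter, mem_range] at ht
  obtain ⟨htn, h1, h2⟩ := ht
  have hmem : S.swapped (a + t) ∈ (C t).powersetCard 2 :=
    mem_powersetCard.2 ⟨S.swapped_subset_kCenter h1 h2, S.card_swapped _⟩
  generalize S.swapped (a + t) = P at hmem
  by_contra hnot
  simp only [mem_union, mem_biUnion, mem_range, mem_sdiff, not_or, not_exists, not_and,
    not_not] at hnot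
  obtain ⟨hs, hstep⟩ := hnot
  have hdown : ∀ u v, u ≤ v → v ≤ n.choose 2 → P ∈ (C v).powersetCard 2 →
      P ∈ (C u).powersetCard 2 := by
    intro u v huv
    induction v, huv using Nat.le_induction with
    | base => exact fun _ h => h
    | succ v _ ih => exact fun hv h => ih (by omega) (hstep v hv h)
  have h0 := hdown 0 t (Nat.zero_le _) htn.le hmem
  have hC0 : C 0 = kCenter k (S.perm a) := by simp [hC]
  rw [hC0] at h0
  -- The centers at times `0` and `n.choose 2` coincide, so the descent can restart from the end and
  -- reach `i`, even when `t < i`.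
  have hI := hdown i _ hi le_rfl (by simp only [hC, hper]; exact h0)
  rw [mem_powersetCard] at h0 hI
  exact hs (mem_powersetCard.2 ⟨subset_inter h0.1 hI.1, hI.2⟩)

end SimpleAllowableSequence

theorem mainTheorem2 (n k : ℕ) (hk : 1 ≤ k) (hkn : 2 * k < n)
    (S : SimpleAllowableSequence n)
    (π : Fin (n.choose 2 + 1) → Equiv.Perm (Fin n)) (hπ : S.IsHalfperiod π)
    (s : ℕ) (hs : s = centerMin k π) :
    S.Ege k ≤ (n - 2 * k - 1) * S.E (k - 1) + s.choose 2 ∧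
    (n - 2 * k - 1) * S.E (k - 1) + s.choose 2 ≤
      (n - 2 * k - 1) * S.E (k - 1) + (n - 2 * k - 1).choose 2 ∧
    n - s ≤ S.E (k - 1) ∧
    2 * k + 1 ≤ n - s := by
  obtain ⟨a, rfl⟩ := hπ
  have hw0 : S.window a 0 = S.perm a := by simp [SimpleAllowableSequence.window]
  obtain ⟨i, -, hi⟩ := Finset.exists_mem_eq_inf' (Finset.univ_nonempty (α := Fin (n.choose 2 + 1)))
    (fun i => #(kCenter k (S.window a 0) ∩ kCenter k (S.window a i)))
  have hsi : s = #(kCenter k (S.perm a) ∩ kCenter k (S.perm (a + ((i : ℕ) : ℤ)))) := by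
    rw [hs, ← hw0]
    exact hi
  have hin : (i : ℕ) ≤ n.choose 2 := Nat.lt_succ_iff.1 i.isLt
  obtain ⟨j, hj, hlt⟩ := S.exists_card_inter_lt hk hkn a
  have hsj : s ≤ #(kCenter k (S.perm a) ∩ kCenter k (S.perm (a + (j : ℤ)))) := by
    rw [hs, ← hw0]
    exact Finset.inf'_le (fun i => #(kCenter k (S.window a 0) ∩ kCenter k (S.window a i)))
      (Finset.mem_univ (⟨j, Nat.lt_succ_iff.2 hj⟩ : Fin (n.choose 2 + 1)))
  refine ⟨?_, Nat.add_le_add_left (Nat.choose_le_choose 2 (by omega)) _, ?_, by omega⟩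
  · rw [hsi]
    exact S.Ege_le hk hkn a hin
  · rw [hsi]
    exact S.sub_card_inter_le_E hk hkn a hin
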